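/- Let $n\in\mathbb N_0$ and let $\mu=(\mu_1,\dots,\mu_n)\in\mathbb R^n$ with $\mu_i\ge -\tfrac12$ for all $i$. Write $\mathbb R^n_+=(0,\infty)^n$, $x^{s}=\prod_i x_i^{s_i}$, $\|x\|$ for the Euclidean norm, $|k|=k_1+\dots+k_n$ for a multi-index $k\in\mathbb N_0^n$, and $T^k=T_n^{k_n}\circ\cdots\circ T_1^{k_1}$ with $T_i=x_i^{-1}\,\partial/\partial x_i$. Let $\mathcal H_\mu$ be the space of all complex-valued $\phi\in C^\infty(\mathbb R^n_+)$ such that for all $m\in\mathbb N_0$, $k\in\mathbb N_0^n$ $$\gamma^\mu_{m,k}(\phi)=\sup_{x\in\mathbb R^n_+}\bigl|(1+\|x\|^2)^m\,T^k\{x^{-\mu-1/2}\phi(x)\}\bigr|<\infty ,\qquad x^{-\mu-1/2}=\prod_{i}x_i^{-\mu_i-1/2},$$ with the topology generated by the seminorms $\gamma^\mu_{m,k}$, and let $\mathcal H'_\mu$ be its dual space, the space of continuous linear functionals on $\mathcal H_\mu$. For $k\in\mathbb N_0^n$ let $S^k=S_{\mu_1}^{k_1}\circ\cdots\circ S_{\mu_n}^{k_n}$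 with $$S_{\mu_i}=\frac{\partial^2}{\partial x_i^2}-\frac{4\mu_i^2-1}{4x_i^2};$$ these are continuous linear operators on $\mathcal H_\mu$, extended to $\mathcal H'_\mu$ by $(S^kf,\phi)=(f,S^k\phi)$. Let $\delta_\mu\in\mathcal H'_\mu$ be given by $$(\delta_\mu,\phi)=C_\mu\lim_{x\to0,\;x\in\mathbb R^n_+}x^{-\mu-1/2}\phi(x),\qquad C_\mu=\prod_{i=1}^n2^{\mu_i}\Gamma(\mu_i+1).$$ Let $T\in\mathcal H'_\mu$ be such that $(T,\phi)=0$ for every $\phi\in\mathcal H_\mu$ for which there is some $a>0$ with $\operatorname{supp}\phi\subset\{x\in\mathbb R^n_+:\|x\|\ge a\}$. Then there exist $N\in\mathbb N_0$ and scalars $c_k\in\mathbb C$, $|k|\le N$, such that $$T=\sum_{|k|\le N}c_k\,S^k\delta_\mu .$$ -/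

import Mathlib

open scoped ContDiff Topology

noncomputable section

namespace Zemanian

/-- Euclidean space `ℝⁿ`. -/
abbrev E (n : ℕ) : Type := EuclideanSpace ℝ (Fin n)

/-- The open positive orthant `(0,∞)ⁿ`. -/
def orthant (n : ℕ) : Set (E n) := {x | ∀ i, 0 < x i}

lemma isOpen_orthant (n : ℕ) : IsOpen (orthant n) := by
  have : orthant n = ⋂ i, {x : E n | 0 < x i} := by
    ext x; simp [orthant]
  rw [this]
  exact isOpen_iInter_of_finite fun i => isOpen_lt continuous_const (by fun_prop)

/-- The space `C^∞((0,∞)ⁿ)` of smooth complex-valued functions on the open orthant; such a function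
is represented by its extension by zero to `ℝⁿ`. -/
def smoothFn (n : ℕ) : Submodule ℂ (E n → ℂ) where
  carrier := {f | ContDiffOn ℝ ∞ f (orthant n) ∧ ∀ x, x ∉ orthant n → f x = 0}
  add_mem' hf hg := ⟨hf.1.add hg.1, fun x hx => by simp [hf.2 x hx, hg.2 x hx]⟩
  zero_mem' := ⟨contDiffOn_const, fun _ _ => rfl⟩
  smul_mem' c f hf := ⟨hf.1.const_smul c, fun x hx => by simp [hf.2 x hx]⟩

variable {n : ℕ}

lemma smoothFn_contDiffAt (f : smoothFn n) {x : E n} (hx : x ∈ orthant n) :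
    ContDiffAt ℝ ∞ (f : E n → ℂ) x :=
  f.2.1.contDiffAt ((isOpen_orthant n).mem_nhds hx)

lemma smoothFn_differentiableAt (f : smoothFn n) {x : E n} (hx : x ∈ orthant n) :
    DifferentiableAt ℝ (f : E n → ℂ) x :=
  (smoothFn_contDiffAt f hx).differentiableAt (by simp)

lemma smoothFn_ext {f g : smoothFn n}
    (h : ∀ x ∈ orthant n, (f : E n → ℂ) x = (g : E n → ℂ) x) : f = g := by
  ext x
  by_cases hx : x ∈ orthant n
  · exact h x hx
  · rw [f.2.2 x hx, g.2.2 x hx]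

/-- The partial derivative `∂/∂xᵢ` on `C^∞((0,∞)ⁿ)`. -/
def partialD (i : Fin n) : Module.End ℂ (smoothFn n) where
  toFun f := ⟨(orthant n).indicator
      (fun x => fderiv ℝ (f : E n → ℂ) x (EuclideanSpace.single i 1)), by
    constructor
    · have h : ContDiffOn ℝ ∞
          (fun x => fderiv ℝ (f : E n → ℂ) x (EuclideanSpace.single i 1)) (orthant n) :=
        (f.2.1.fderiv_of_isOpen (isOpen_orthant n) (by simp)).clm_apply contDiffOn_const
      exact h.congr fun x hx => Set.indicator_of_mem hx _
    · exact fun x hx => Set.indicator_of_notMem hx _⟩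
  map_add' f g := smoothFn_ext fun x hx => by
    simp [hx, fderiv_add (smoothFn_differentiableAt f hx) (smoothFn_differentiableAt g hx)]
  map_smul' c f := smoothFn_ext fun x hx => by
    simp [hx, fderiv_const_smul (smoothFn_differentiableAt f hx)]

/-- Multiplication by a function `w` that is smooth on the open orthant. -/
def mulBy (w : E n → ℂ) (hw : ContDiffOn ℝ ∞ w (orthant n)) : Module.End ℂ (smoothFn n) where
  toFun f := ⟨fun x => w x * (f : E n → ℂ) x, hw.mul f.2.1, fun x hx => by simp [f.2.2 x hx]⟩
  map_add' f g := by ext x; simp [mul_add]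
  map_smul' c f := by ext x; simp; ring

lemma coord_contDiff (i : Fin n) : ContDiff ℝ ∞ (fun x : E n => (x i : ℂ)) :=
  Complex.ofRealCLM.contDiff.comp (by fun_prop : ContDiff ℝ ∞ fun x : E n => x i)

lemma coord_ne_zero (i : Fin n) {x : E n} (hx : x ∈ orthant n) : (x i : ℂ) ≠ 0 :=
  Complex.ofReal_ne_zero.2 (hx i).ne'

lemma inv_contDiffOn (i : Fin n) : ContDiffOn ℝ ∞ (fun x : E n => (x i : ℂ)⁻¹) (orthant n) :=
  (coord_contDiff i).contDiffOn.inv fun _ hx => coord_ne_zero i hx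

lemma potential_contDiffOn (a : ℝ) (i : Fin n) :
    ContDiffOn ℝ ∞ (fun x : E n => (4 * (a : ℂ) ^ 2 - 1) / (4 * (x i : ℂ) ^ 2)) (orthant n) := by
  simp only [div_eq_mul_inv]
  refine contDiffOn_const.mul (ContDiffOn.inv ?_ fun x hx => ?_)
  · exact contDiffOn_const.mul ((coord_contDiff i).contDiffOn.pow 2)
  · exact mul_ne_zero (by norm_num) (pow_ne_zero 2 (coord_ne_zero i hx))

lemma rpow_contDiffOn (s : Fin n → ℝ) :
    ContDiffOn ℝ ∞ (fun x : E n => ((∏ i, x i ^ s i : ℝ) : ℂ)) (orthant n) := by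
  have h : ContDiffOn ℝ ∞ (fun x : E n => ∏ i, x i ^ s i) (orthant n) :=
    contDiffOn_prod fun i _ =>
      ContDiffOn.rpow_const_of_ne (by fun_prop) fun x hx => (hx i).ne'
  exact Complex.ofRealCLM.contDiff.comp_contDiffOn h

/-- Multiplication by `x^s = ∏ᵢ xᵢ^{sᵢ}`, for real exponents `sᵢ`. -/
def mulRpow (s : Fin n → ℝ) : Module.End ℂ (smoothFn n) :=
  mulBy (fun x => ((∏ i, x i ^ s i : ℝ) : ℂ)) (rpow_contDiffOn s)

/-- Multiplication by `x^{-μ-1/2}`. -/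
def weight (μ : Fin n → ℝ) : Module.End ℂ (smoothFn n) := mulRpow fun i => -μ i - 1 / 2

/-- The operator `Tᵢ = xᵢ⁻¹ ∂/∂xᵢ`. -/
def T (i : Fin n) : Module.End ℂ (smoothFn n) :=
  mulBy (fun x => (x i : ℂ)⁻¹) (inv_contDiffOn i) * partialD i

/-- The operator `T^k = Tₙ^{kₙ} ∘ ⋯ ∘ T₁^{k₁}`. -/
def Tpow (k : Fin n → ℕ) : Module.End ℂ (smoothFn n) :=
  ((List.finRange n).reverse.map fun i => T i ^ k i).prod

/-- The Bessel operator `S_{μᵢ} = ∂²/∂xᵢ² - (4μᵢ² - 1)/(4xᵢ²)` on `C^∞((0,∞)ⁿ)`. -/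
def besselS (μ : Fin n → ℝ) (i : Fin n) : Module.End ℂ (smoothFn n) :=
  partialD i ^ 2 -
    mulBy (fun x => (4 * (μ i : ℂ) ^ 2 - 1) / (4 * (x i : ℂ) ^ 2)) (potential_contDiffOn (μ i) i)

/-- The function `(1 + ‖x‖²)^m T^k{x^{-μ-1/2} φ(x)}`, whose supremum norm over the orthant is
`γ_{m,k}^μ(φ)`. -/
def gammaFn (μ : Fin n → ℝ) (m : ℕ) (k : Fin n → ℕ) (φ : smoothFn n) (x : E n) : ℂ :=
  ((1 + ‖x‖ ^ 2 : ℝ) : ℂ) ^ m * (Tpow k (weight μ φ) : E n → ℂ) x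

lemma gammaFn_add (μ : Fin n → ℝ) (m : ℕ) (k : Fin n → ℕ) (φ ψ : smoothFn n) (x : E n) :
    gammaFn μ m k (φ + ψ) x = gammaFn μ m k φ x + gammaFn μ m k ψ x := by
  simp [gammaFn, mul_add]

lemma gammaFn_smul (μ : Fin n → ℝ) (m : ℕ) (k : Fin n → ℕ) (c : ℂ) (φ : smoothFn n) (x : E n) :
    gammaFn μ m k (c • φ) x = c * gammaFn μ m k φ x := by
  simp [gammaFn]; ring

/-- The functions `φ` in `C^∞((0,∞)ⁿ)` for which all `γ_{m,k}^μ(φ)` are finite. -/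
def space (μ : Fin n → ℝ) : Submodule ℂ (smoothFn n) where
  carrier := {φ | ∀ (m : ℕ) (k : Fin n → ℕ),
    BddAbove (Set.range fun x : orthant n => ‖gammaFn μ m k φ x‖)}
  add_mem' {φ ψ} hφ hψ m k := by
    obtain ⟨A, hA⟩ := hφ m k
    obtain ⟨B, hB⟩ := hψ m k
    refine ⟨A + B, ?_⟩
    rintro _ ⟨x, rfl⟩
    simp only [gammaFn_add]
    exact (norm_add_le _ _).trans (add_le_add (hA ⟨x, rfl⟩) (hB ⟨x, rfl⟩))
  zero_mem' m k := ⟨0, by rintro _ ⟨x, rfl⟩; simp [gammaFn]⟩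
  smul_mem' c φ hφ m k := by
    obtain ⟨A, hA⟩ := hφ m k
    refine ⟨‖c‖ * A, ?_⟩
    rintro _ ⟨x, rfl⟩
    simp only [gammaFn_smul, norm_mul]
    exact mul_le_mul_of_nonneg_left (hA ⟨x, rfl⟩) (norm_nonneg c)

/-- The Zemanian space `H_μ`. -/
def H (μ : Fin n → ℝ) : Type := space μ

instance (μ : Fin n → ℝ) : AddCommGroup (H μ) := inferInstanceAs (AddCommGroup (space μ))

instance (μ : Fin n → ℝ) : Module ℂ (H μ) := inferInstanceAs (Module ℂ (space μ))

/-- The inclusion of `H_μ` into `C^∞((0,∞)ⁿ)`. -/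
def H.incl (μ : Fin n → ℝ) : H μ →ₗ[ℂ] smoothFn n := (space μ).subtype

/-- An element of `H_μ` as a function on `ℝⁿ`, vanishing off the orthant. -/
def H.toFun {μ : Fin n → ℝ} (φ : H μ) : E n → ℂ := (H.incl μ φ : E n → ℂ)

lemma orthant_nonempty (n : ℕ) : Nonempty (orthant n) :=
  ⟨⟨WithLp.toLp 2 fun _ => 1, fun i => by simp⟩⟩

lemma gammaFn_le {μ : Fin n → ℝ} (m : ℕ) (k : Fin n → ℕ) (φ : H μ) {x : E n}
    (hx : x ∈ orthant n) :
    ‖gammaFn μ m k (H.incl μ φ) x‖ ≤ ⨆ y : orthant n, ‖gammaFn μ m k (H.incl μ φ) y‖ :=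
  le_ciSup (f := fun y : orthant n => ‖gammaFn μ m k (H.incl μ φ) y‖) (φ.2 m k) ⟨x, hx⟩

/-- The seminorm `γ_{m,k}^μ(φ) = sup_{x ∈ (0,∞)ⁿ} |(1 + ‖x‖²)^m T^k{x^{-μ-1/2} φ(x)}|`. -/
def gamma (μ : Fin n → ℝ) (p : ℕ × (Fin n → ℕ)) : Seminorm ℂ (H μ) :=
  Seminorm.ofSMulLE (fun φ => ⨆ x : orthant n, ‖gammaFn μ p.1 p.2 (H.incl μ φ) x‖)
    (by simp [gammaFn])
    (fun φ ψ => by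
      have := orthant_nonempty n
      refine ciSup_le fun x => ?_
      rw [map_add, gammaFn_add]
      exact (norm_add_le _ _).trans
        (add_le_add (gammaFn_le _ _ φ x.2) (gammaFn_le _ _ ψ x.2)))
    (fun c φ => by
      have := orthant_nonempty n
      refine ciSup_le fun x => ?_
      rw [map_smul, gammaFn_smul, norm_mul]
      exact mul_le_mul_of_nonneg_left (gammaFn_le _ _ φ x.2) (norm_nonneg c))

lemma gamma_apply (μ : Fin n → ℝ) (p : ℕ × (Fin n → ℕ)) (φ : H μ) :
    gamma μ p φ = ⨆ x : orthant n, ‖gammaFn μ p.1 p.2 (H.incl μ φ) x‖ := rfl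

/-- The topology of `H_μ`, generated by the seminorms `γ_{m,k}^μ`. -/
instance (μ : Fin n → ℝ) : TopologicalSpace (H μ) :=
  (SeminormFamily.moduleFilterBasis (gamma μ)).topology

lemma withSeminorms_gamma (μ : Fin n → ℝ) : WithSeminorms (gamma μ) := ⟨rfl⟩

instance (μ : Fin n → ℝ) : IsTopologicalAddGroup (H μ) :=
  (withSeminorms_gamma μ).topologicalAddGroup

instance (μ : Fin n → ℝ) : ContinuousSMul ℂ (H μ) := (withSeminorms_gamma μ).continuousSMul

/-! Calculus of the operators. -/

lemma partialD_apply (i : Fin n) (f : smoothFn n) {x : E n} (hx : x ∈ orthant n) :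
    (partialD i f : E n → ℂ) x = fderiv ℝ (f : E n → ℂ) x (EuclideanSpace.single i 1) :=
  Set.indicator_of_mem hx (fun x => fderiv ℝ (f : E n → ℂ) x (EuclideanSpace.single i 1))

lemma mulBy_apply (w : E n → ℂ) (hw : ContDiffOn ℝ ∞ w (orthant n)) (f : smoothFn n) (x : E n) :
    (mulBy w hw f : E n → ℂ) x = w x * (f : E n → ℂ) x := rfl

lemma partialD_mulBy (i : Fin n) (w : E n → ℂ) (hw : ContDiffOn ℝ ∞ w (orthant n))
    (f : smoothFn n) {x : E n} (hx : x ∈ orthant n) :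
    (partialD i (mulBy w hw f) : E n → ℂ) x =
      fderiv ℝ w x (EuclideanSpace.single i 1) * (f : E n → ℂ) x +
        w x * (partialD i f : E n → ℂ) x := by
  have hw' : DifferentiableAt ℝ w x :=
    (hw.contDiffAt ((isOpen_orthant n).mem_nhds hx)).differentiableAt (by simp)
  rw [partialD_apply i _ hx, partialD_apply i _ hx]
  have : (mulBy w hw f : E n → ℂ) = fun y => w y * (f : E n → ℂ) y := rfl
  rw [this, fderiv_fun_mul hw' (smoothFn_differentiableAt f hx)]
  simp
  ring

lemma partialD_comm (i j : Fin n) (f : smoothFn n) :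
    partialD i (partialD j f) = partialD j (partialD i f) := by
  refine smoothFn_ext fun x hx => ?_
  have key : ∀ i j : Fin n, (partialD i (partialD j f) : E n → ℂ) x =
      fderiv ℝ (fderiv ℝ (f : E n → ℂ)) x (EuclideanSpace.single i 1)
        (EuclideanSpace.single j 1) := by
    intro i j
    rw [partialD_apply i _ hx]
    have h1 : (partialD j f : E n → ℂ) =ᶠ[𝓝 x]
        fun y => fderiv ℝ (f : E n → ℂ) y (EuclideanSpace.single j 1) := by
      filter_upwards [(isOpen_orthant n).mem_nhds hx] with y hy using partialD_apply j f hy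
    have h2 : DifferentiableAt ℝ (fderiv ℝ (f : E n → ℂ)) x :=
      ((smoothFn_contDiffAt f hx).fderiv_right (m := 1) (by norm_cast)).differentiableAt (by simp)
    rw [h1.fderiv_eq, fderiv_clm_apply h2 (by fun_prop)]
    simp
  rw [key, key]
  exact (smoothFn_contDiffAt f hx).isSymmSndFDerivAt (by simp; norm_cast) _ _

/-- The `j`-th coordinate as a continuous linear map. -/
def coordCLM (j : Fin n) : E n →L[ℝ] ℝ := EuclideanSpace.proj j

lemma coordCLM_apply (j : Fin n) (x : E n) : coordCLM j x = x j := rfl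

lemma fderiv_coord (i j : Fin n) (q : ℝ → ℂ) (q' : ℂ) (x : E n) (hq : HasDerivAt q q' (x j)) :
    fderiv ℝ (fun y : E n => q (y j)) x (EuclideanSpace.single i 1) = if j = i then q' else 0 := by
  have h := HasFDerivAt.comp (f := coordCLM j) x hq.hasFDerivAt
    (coordCLM j).hasFDerivAt
  have h' : HasFDerivAt (fun y : E n => q (y j)) _ x := h
  rw [h'.fderiv]
  by_cases hij : j = i <;> simp [hij, coordCLM_apply]

lemma hasDerivAt_inv' {r : ℝ} (hr : r ≠ 0) :
    HasDerivAt (fun t : ℝ => (t : ℂ)⁻¹) (-((r : ℂ) ^ 2)⁻¹) r := by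
  have := (hasDerivAt_inv hr).ofReal_comp
  simpa using this

lemma hasDerivAt_sq' (r : ℝ) : HasDerivAt (fun t : ℝ => (t : ℂ) ^ 2) (2 * (r : ℂ)) r := by
  have := (hasDerivAt_pow 2 r).ofReal_comp
  simpa using this

lemma fderiv_rpow (s : Fin n → ℝ) (i : Fin n) {x : E n} (hx : x ∈ orthant n) :
    fderiv ℝ (fun y : E n => ((∏ j, y j ^ s j : ℝ) : ℂ)) x (EuclideanSpace.single i 1) =
      s i * (x i : ℂ)⁻¹ * ((∏ j, x j ^ s j : ℝ) : ℂ) := by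
  have h1 : ∀ j ∈ Finset.univ, HasFDerivAt (fun y : E n => y j ^ s j)
      ((s j * x j ^ (s j - 1)) • coordCLM j) x := by
    intro j _
    exact HasDerivAt.comp_hasFDerivAt (f := coordCLM j) x
      (Real.hasDerivAt_rpow_const (Or.inl (hx j).ne'))
      (coordCLM j).hasFDerivAt
  have h2 := Complex.ofRealCLM.hasFDerivAt.comp x (HasFDerivAt.finsetProd h1)
  have h3 : HasFDerivAt (fun y : E n => ((∏ j, y j ^ s j : ℝ) : ℂ)) _ x := h2
  rw [h3.fderiv]
  have h4 : x i ^ (s i - 1) = x i ^ s i * (x i)⁻¹ := by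
    rw [Real.rpow_sub_one (hx i).ne', div_eq_mul_inv]
  simp [coordCLM_apply]
  rw [← Finset.mul_prod_erase Finset.univ _ (Finset.mem_univ i), h4]
  push_cast
  ring

/-- Multiplication by `xᵢ²`. -/
def mulSq (i : Fin n) : Module.End ℂ (smoothFn n) :=
  mulBy (fun x => (x i : ℂ) ^ 2) ((coord_contDiff i).contDiffOn.pow 2)

lemma T_apply (i : Fin n) (f : smoothFn n) (x : E n) :
    (T i f : E n → ℂ) x = (x i : ℂ)⁻¹ * (partialD i f : E n → ℂ) x := rfl

lemma partialD_T (i j : Fin n) (f : smoothFn n) {x : E n} (hx : x ∈ orthant n) :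
    (partialD i (T j f) : E n → ℂ) x =
      (if j = i then -((x j : ℂ) ^ 2)⁻¹ else 0) * (partialD j f : E n → ℂ) x +
        (x j : ℂ)⁻¹ * (partialD i (partialD j f) : E n → ℂ) x := by
  have := partialD_mulBy i _ (inv_contDiffOn j) (partialD j f) hx
  rw [fderiv_coord i j (fun t => (t : ℂ)⁻¹) _ x (hasDerivAt_inv' (hx j).ne')] at this
  exact this

lemma T_commute (i j : Fin n) : Commute (T i) (T j) := by
  refine LinearMap.ext fun f => smoothFn_ext fun x hx => ?_
  rcases eq_or_ne i j with rfl | hij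
  · rfl
  rw [Module.End.mul_apply, Module.End.mul_apply, T_apply, T_apply, partialD_T i j f hx,
    partialD_T j i f hx, partialD_comm i j]
  simp [hij, hij.symm]
  ring

lemma T_mulSq (i j : Fin n) :
    T j * mulSq i = mulSq i * T j + (if i = j then (2 : ℂ) else 0) • 1 := by
  refine LinearMap.ext fun f => smoothFn_ext fun x hx => ?_
  have h := partialD_mulBy j _ ((coord_contDiff i).contDiffOn.pow 2) f hx
  rw [fderiv_coord j i (fun t => (t : ℂ) ^ 2) _ x (hasDerivAt_sq' (x i))] at h
  have h0 := coord_ne_zero i hx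
  have h' : (T j (mulSq i f) : E n → ℂ) x = (x j : ℂ)⁻¹ * _ := congrArg ((x j : ℂ)⁻¹ * ·) h
  have h1 : (mulSq i (T j f) : E n → ℂ) x =
    (x i : ℂ) ^ 2 * ((x j : ℂ)⁻¹ * (partialD j f : E n → ℂ) x) := rfl
  simp only [Module.End.mul_apply, LinearMap.add_apply, LinearMap.smul_apply,
    Module.End.one_apply, Submodule.coe_add, Submodule.coe_smul, Pi.add_apply, Pi.smul_apply]
  rw [h', h1]
  by_cases hij : i = j
  · subst hij
    simp only [if_true, smul_eq_mul]
    field_simp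
    ring
  · simp [hij]; ring

lemma weight_besselS (μ : Fin n → ℝ) (i : Fin n) :
    weight μ * besselS μ i =
      (mulSq i * T i ^ 2 + (2 * (μ i : ℂ) + 2) • T i) * weight μ := by
  set Y : Module.End ℂ (smoothFn n) := mulBy (fun x => (x i : ℂ)⁻¹) (inv_contDiffOn i) with hY
  have hYa : ∀ (h : smoothFn n) (x : E n), (Y h : E n → ℂ) x = (x i : ℂ)⁻¹ * (h : E n → ℂ) x :=
    fun _ _ => rfl
  have hW : ∀ h : smoothFn n, weight μ (partialD i h) =
      partialD i (weight μ h) + ((μ i : ℂ) + 1 / 2) • Y (weight μ h) := by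
    intro h
    refine smoothFn_ext fun x hx => ?_
    have h1 := partialD_mulBy i _ (rpow_contDiffOn fun i => -μ i - 1 / 2) h hx
    rw [fderiv_rpow _ i hx] at h1
    have h2 : ∀ (g : smoothFn n), (weight μ g : E n → ℂ) x =
      ((∏ j, x j ^ (-μ j - 1 / 2) : ℝ) : ℂ) * (g : E n → ℂ) x := fun _ => rfl
    have h3 : (partialD i (weight μ h) : E n → ℂ) x = _ := h1
    simp only [Submodule.coe_add, Submodule.coe_smul, Pi.add_apply, Pi.smul_apply, smul_eq_mul]
    rw [h3, hYa, h2, h2]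
    push_cast
    ring
  refine LinearMap.ext fun f => smoothFn_ext fun x hx => ?_
  have h0 := coord_ne_zero i hx
  have hDY : ∀ h : smoothFn n, (partialD i (Y h) : E n → ℂ) x =
      -((x i : ℂ) ^ 2)⁻¹ * (h : E n → ℂ) x + (x i : ℂ)⁻¹ * (partialD i h : E n → ℂ) x := by
    intro h
    have := partialD_mulBy i _ (inv_contDiffOn i) h hx
    rw [fderiv_coord i i (fun t => (t : ℂ)⁻¹) _ x (hasDerivAt_inv' (hx i).ne'), if_pos rfl] at this
    exact this
  have hL : (weight μ (besselS μ i f) : E n → ℂ) x =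
      (weight μ (partialD i (partialD i f)) : E n → ℂ) x -
        (4 * (μ i : ℂ) ^ 2 - 1) / (4 * (x i : ℂ) ^ 2) * (weight μ f : E n → ℂ) x := by
    have h2 : ∀ (g : smoothFn n), (weight μ g : E n → ℂ) x =
      ((∏ j, x j ^ (-μ j - 1 / 2) : ℝ) : ℂ) * (g : E n → ℂ) x := fun _ => rfl
    have h3 : (besselS μ i f : E n → ℂ) x = (partialD i (partialD i f) : E n → ℂ) x -
        (4 * (μ i : ℂ) ^ 2 - 1) / (4 * (x i : ℂ) ^ 2) * (f : E n → ℂ) x := rfl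
    rw [h2, h2, h2, h3]
    ring
  have hR : (mulSq i (T i (T i (weight μ f))) : E n → ℂ) x = (x i : ℂ) ^ 2 *
      ((x i : ℂ)⁻¹ * (partialD i (T i (weight μ f)) : E n → ℂ) x) := rfl
  rw [partialD_T i i _ hx, if_pos rfl] at hR
  simp only [Module.End.mul_apply, LinearMap.add_apply, LinearMap.smul_apply, pow_two (T i),
    Submodule.coe_add, Submodule.coe_smul, Pi.add_apply, Pi.smul_apply, smul_eq_mul]
  rw [hL, hR, T_apply, hW, hW]
  simp only [map_add, map_smul, Submodule.coe_add, Submodule.coe_smul, Pi.add_apply,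
    Pi.smul_apply, smul_eq_mul, hYa, hDY]
  field_simp
  ring

/-! Products of powers of the `Tᵢ`. -/

lemma Tlist_succ (i : Fin n) (k : Fin n → ℕ) (L : List (Fin n)) (hL : L.Nodup) :
    (L.map fun j => T j ^ (k + Pi.single i 1 : Fin n → ℕ) j).prod =
      (L.map fun j => T j ^ k j).prod * (if i ∈ L then T i else 1) := by
  induction L with
  | nil => simp
  | cons a L ih =>
    rw [List.nodup_cons] at hL
    simp only [List.map_cons, List.prod_cons, ih hL.2]
    rcases eq_or_ne i a with rfl | hia
    · have hc : Commute (T i) (L.map fun j => T j ^ k j).prod := by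
        refine Commute.list_prod_right _ _ fun y hy => ?_
        obtain ⟨j, _, rfl⟩ := List.mem_map.1 hy
        exact (T_commute i j).pow_right _
      simp [hL.1, pow_succ, mul_assoc, hc.eq]
    · simp [hia, hia.symm, mul_assoc]

lemma Tpow_succ (i : Fin n) (k : Fin n → ℕ) : Tpow (k + Pi.single i 1) = Tpow k * T i := by
  have := Tlist_succ i k (List.finRange n).reverse (List.nodup_reverse.2 (List.nodup_finRange n))
  simpa [Tpow] using this

lemma T_pow_mulSq (i j : Fin n) (r : ℕ) :
    ∃ (c : ℂ) (r' : ℕ), T j ^ r * mulSq i = mulSq i * T j ^ r + c • T j ^ r' ∧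
      (i ≠ j → c = 0) := by
  induction r with
  | zero => exact ⟨0, 0, by simp, fun _ => rfl⟩
  | succ r ih =>
    obtain ⟨c, r', h, hc⟩ := ih
    by_cases hij : i = j
    · refine ⟨(r + 1) * 2, r, ?_, fun h => absurd hij h⟩
      subst hij
      clear h hc
      induction r with
      | zero => simp [T_mulSq]
      | succ r ih =>
        rw [pow_succ' _ (r + 1), mul_assoc, ih, mul_add, ← mul_assoc, T_mulSq, if_pos rfl,
          mul_smul_comm, ← pow_succ', add_mul, smul_one_mul, mul_assoc, ← pow_succ', add_assoc,
          ← add_smul]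
        push_cast
        ring_nf
    · refine ⟨0, 0, ?_, fun _ => rfl⟩
      rw [hc hij, zero_smul, add_zero] at h
      rw [zero_smul, add_zero, pow_succ, mul_assoc, T_mulSq, if_neg hij, zero_smul, add_zero,
        ← mul_assoc, h, mul_assoc]

lemma Tlist_mulSq (i : Fin n) (k : Fin n → ℕ) (L : List (Fin n)) (hL : L.Nodup) :
    ∃ (c : ℂ) (k' : Fin n → ℕ), (L.map fun j => T j ^ k j).prod * mulSq i =
      mulSq i * (L.map fun j => T j ^ k j).prod + c • (L.map fun j => T j ^ k' j).prod := by
  induction L with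
  | nil => exact ⟨0, 0, by simp⟩
  | cons a L ih =>
    rw [List.nodup_cons] at hL
    obtain ⟨c, k', h⟩ := ih hL.2
    obtain ⟨d, r', h', hd⟩ := T_pow_mulSq i a (k a)
    by_cases hia : i = a
    · have hcomm : (L.map fun j => T j ^ k j).prod * mulSq i =
          mulSq i * (L.map fun j => T j ^ k j).prod := by
        have : Commute (mulSq i) (L.map fun j => T j ^ k j).prod := by
          refine Commute.list_prod_right _ _ fun y hy => ?_
          obtain ⟨j, hj, rfl⟩ := List.mem_map.1 hy
          refine Commute.pow_right ?_ _
          have := T_mulSq i j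
          rw [if_neg (by rintro rfl; exact hL.1 (hia ▸ hj)), zero_smul, add_zero] at this
          exact this.symm
        exact this.eq.symm
      refine ⟨d, Function.update k a r', ?_⟩
      have hu : (L.map fun j => T j ^ Function.update k a r' j) = L.map fun j => T j ^ k j := by
        refine List.map_congr_left fun j hj => ?_
        rw [Function.update_of_ne (by rintro rfl; exact hL.1 hj)]
      simp only [List.map_cons, List.prod_cons, hu, Function.update_self]
      rw [mul_assoc, hcomm, ← mul_assoc, h', add_mul, smul_mul_assoc, mul_assoc]
    · refine ⟨c, Function.update k' a (k a), ?_⟩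
      have hu : (L.map fun j => T j ^ Function.update k' a (k a) j) =
          L.map fun j => T j ^ k' j := by
        refine List.map_congr_left fun j hj => ?_
        rw [Function.update_of_ne (by rintro rfl; exact hL.1 hj)]
      simp only [List.map_cons, List.prod_cons, hu, Function.update_self]
      rw [hd hia, zero_smul, add_zero] at h'
      rw [mul_assoc, h, mul_add, ← mul_assoc, h', mul_smul_comm, mul_assoc]

lemma Tpow_mulSq (i : Fin n) (k : Fin n → ℕ) :
    ∃ (c : ℂ) (k' : Fin n → ℕ), Tpow k * mulSq i = mulSq i * Tpow k + c • Tpow k' :=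
  Tlist_mulSq i k _ (List.nodup_reverse.2 (List.nodup_finRange n))

lemma gammaFn_besselS (μ : Fin n → ℝ) (i : Fin n) (m : ℕ) (k : Fin n → ℕ) :
    ∃ (c d : ℂ) (k₁ k₂ k₃ : Fin n → ℕ), ∀ (φ : smoothFn n) (x : E n),
      ‖gammaFn μ m k (besselS μ i φ) x‖ ≤ ‖gammaFn μ (m + 1) k₁ φ x‖ +
        ‖c‖ * ‖gammaFn μ m k₂ φ x‖ + ‖d‖ * ‖gammaFn μ m k₃ φ x‖ := by
  obtain ⟨c, k', h⟩ := Tpow_mulSq i k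
  refine ⟨c, 2 * (μ i : ℂ) + 2, k + Pi.single i 1 + Pi.single i 1,
    k' + Pi.single i 1 + Pi.single i 1, k + Pi.single i 1, fun φ x => ?_⟩
  have h1 : Tpow k * (weight μ * besselS μ i) =
      (mulSq i * Tpow (k + Pi.single i 1 + Pi.single i 1) +
        c • Tpow (k' + Pi.single i 1 + Pi.single i 1) +
        (2 * (μ i : ℂ) + 2) • Tpow (k + Pi.single i 1)) * weight μ := by
    rw [weight_besselS, ← mul_assoc, mul_add, ← mul_assoc, h, Tpow_succ, Tpow_succ, Tpow_succ,
      Tpow_succ, pow_two, mul_smul_comm]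
    simp only [mul_assoc, add_mul, smul_mul_assoc]
  have h2 := congrFun (congrArg Subtype.val (LinearMap.congr_fun h1 φ)) x
  simp only [Module.End.mul_apply, LinearMap.add_apply, LinearMap.smul_apply,
    Submodule.coe_add, Submodule.coe_smul, Pi.add_apply, Pi.smul_apply, smul_eq_mul] at h2
  have h3 : ∀ g : smoothFn n, (mulSq i g : E n → ℂ) x = (x i : ℂ) ^ 2 * (g : E n → ℂ) x :=
    fun _ => rfl
  have hx : ‖(x i : ℂ) ^ 2‖ ≤ ‖((1 + ‖x‖ ^ 2 : ℝ) : ℂ)‖ := by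
    have h4 : |x i| ≤ ‖x‖ := by simpa using PiLp.norm_apply_le x i
    rw [norm_pow, Complex.norm_real, Complex.norm_real, Real.norm_eq_abs,
      Real.norm_of_nonneg (by positivity)]
    nlinarith [abs_nonneg (x i)]
  unfold gammaFn
  rw [h2, h3, mul_add, mul_add]
  refine (norm_add₃_le).trans ?_
  refine add_le_add (add_le_add ?_ ?_) ?_
  · rw [pow_succ _ m, mul_assoc, norm_mul, norm_mul, norm_mul, norm_mul]
    gcongr
  · rw [mul_left_comm, norm_mul]
  · rw [mul_left_comm, norm_mul]

/-- The Bessel operator `S_{μᵢ}` as a linear operator of `H_μ`. -/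
def besselHₗ (μ : Fin n → ℝ) (i : Fin n) : H μ →ₗ[ℂ] H μ :=
  (besselS μ i).restrict (p := space μ) (q := space μ) fun φ hφ m k => by
    obtain ⟨c, d, k₁, k₂, k₃, h⟩ := gammaFn_besselS μ i m k
    obtain ⟨A, hA⟩ := hφ (m + 1) k₁
    obtain ⟨B, hB⟩ := hφ m k₂
    obtain ⟨C, hC⟩ := hφ m k₃
    refine ⟨A + ‖c‖ * B + ‖d‖ * C, ?_⟩
    rintro _ ⟨x, rfl⟩
    refine (h φ x).trans ?_
    gcongr
    · exact hA ⟨x, rfl⟩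
    · exact hB ⟨x, rfl⟩
    · exact hC ⟨x, rfl⟩

lemma besselHₗ_continuous (μ : Fin n → ℝ) (i : Fin n) : Continuous (besselHₗ μ i) := by
  refine WithSeminorms.continuous_of_isBounded (withSeminorms_gamma μ) (withSeminorms_gamma μ) _ ?_
  refine Seminorm.IsBounded.of_real fun p => ?_
  classical
  obtain ⟨c, d, k₁, k₂, k₃, h⟩ := gammaFn_besselS μ i p.1 p.2
  let s : Finset (ℕ × (Fin n → ℕ)) := {(p.1 + 1, k₁), (p.1, k₂), (p.1, k₃)}
  refine ⟨s, 1 + ‖c‖ + ‖d‖, fun φ => ?_⟩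
  have hs : ∀ q ∈ s, ∀ x ∈ orthant n,
      ‖gammaFn μ q.1 q.2 (H.incl μ φ) x‖ ≤ (s.sup (gamma μ)) φ := fun q hq x hx =>
    (gammaFn_le q.1 q.2 φ hx).trans (Seminorm.le_finset_sup_apply (p := gamma μ) (x := φ) hq)
  have := orthant_nonempty n
  refine ciSup_le fun x => ?_
  refine (h (H.incl μ φ) x).trans ?_
  have e1 := hs (p.1 + 1, k₁) (by simp [s]) x x.2
  have e2 := mul_le_mul_of_nonneg_left (hs (p.1, k₂) (by simp [s]) x x.2) (norm_nonneg c)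
  have e3 := mul_le_mul_of_nonneg_left (hs (p.1, k₃) (by simp [s]) x x.2) (norm_nonneg d)
  rw [add_mul, add_mul, one_mul]
  exact add_le_add (add_le_add e1 e2) e3

/-- The Bessel operator `S_{μᵢ}` as a continuous linear operator of `H_μ`. -/
def besselH (μ : Fin n → ℝ) (i : Fin n) : H μ →L[ℂ] H μ := ⟨besselHₗ μ i, besselHₗ_continuous μ i⟩

/-- The operator `S^k = S_{μ₁}^{k₁} ∘ ⋯ ∘ S_{μₙ}^{kₙ}` on `H_μ`. -/
def Spow (μ : Fin n → ℝ) (k : Fin n → ℕ) : H μ →L[ℂ] H μ :=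
  ((List.finRange n).map fun i => besselH μ i ^ k i).prod

/-- The dual space `H'_μ`: the continuous linear functionals on `H_μ`. -/
abbrev Dual (μ : Fin n → ℝ) : Type := H μ →L[ℂ] ℂ

/-- The operator `S^k` on `H'_μ`, given by `(S^k f, φ) = (f, S^k φ)`. -/
def SpowDual (μ : Fin n → ℝ) (k : Fin n → ℕ) (f : Dual μ) : Dual μ := f.comp (Spow μ k)

/-! The generalized delta. -/

lemma neBot_nhdsWithin_orthant (n : ℕ) : (𝓝[orthant n] (0 : E n)).NeBot := by
  rw [← mem_closure_iff_nhdsWithin_neBot]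
  have h : Filter.Tendsto (fun t : ℝ => t • (WithLp.toLp 2 fun _ => 1 : E n)) (𝓝[>] 0) (𝓝 0) := by
    have : Continuous fun t : ℝ => t • (WithLp.toLp 2 fun _ => 1 : E n) := by fun_prop
    simpa using (this.tendsto 0).mono_left nhdsWithin_le_nhds
  refine mem_closure_of_tendsto h ?_
  filter_upwards [self_mem_nhdsWithin] with t ht i
  simpa using ht

lemma convex_orthant (n : ℕ) : Convex ℝ (orthant n) := by
  intro x hx y hy a b ha hb hab i
  have h1 := hx i
  have h2 := hy i
  simp only [PiLp.add_apply, PiLp.smul_apply, smul_eq_mul]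
  rcases ha.eq_or_lt with rfl | ha
  · have : b = 1 := by linarith
    subst this; simpa using h2
  · have := mul_pos ha h1
    have := mul_nonneg hb h2.le
    linarith

lemma Tpow_zero : Tpow (0 : Fin n → ℕ) = 1 := by
  simp [Tpow]

/-- For `φ` in `H_μ` the function `x^{-μ-1/2} φ(x)` has a limit at the origin. -/
lemma exists_limit (μ : Fin n → ℝ) (φ : H μ) :
    ∃ l, Filter.Tendsto (weight μ (H.incl μ φ) : E n → ℂ) (𝓝[orthant n] 0) (𝓝 l) := by
  set g := weight μ (H.incl μ φ) with hg
  have hb : ∀ i : Fin n, ∃ A : ℝ, ∀ x ∈ orthant n,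
      ‖fderiv ℝ (g : E n → ℂ) x (EuclideanSpace.single i 1)‖ ≤ A := by
    intro i
    refine ⟨_, fun x hx => le_trans ?_ (gammaFn_le 1 (0 + Pi.single i 1) φ hx)⟩
    unfold gammaFn
    rw [Tpow_succ, Tpow_zero, one_mul, T_apply, partialD_apply i _ hx, ← hg, ← mul_assoc, norm_mul]
    refine le_mul_of_one_le_left (norm_nonneg _) ?_
    have h0 := hx i
    have h4 : |x i| ≤ ‖x‖ := by simpa using PiLp.norm_apply_le x i
    rw [abs_of_pos h0] at h4
    rw [pow_one, norm_mul, norm_inv, Complex.norm_real, Complex.norm_real,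
      Real.norm_of_nonneg (by positivity), Real.norm_of_nonneg h0.le, ← div_eq_mul_inv,
      one_le_div h0]
    nlinarith [sq_nonneg (‖x‖ - 1)]
  choose A hA using hb
  have hF : ∀ x ∈ orthant n, ‖fderiv ℝ (g : E n → ℂ) x‖ ≤ ∑ i, A i := by
    intro x hx
    have hA0 : ∀ i, 0 ≤ A i := fun i => (norm_nonneg _).trans (hA i x hx)
    refine ContinuousLinearMap.opNorm_le_bound _ (Finset.sum_nonneg fun i _ => hA0 i) fun v => ?_
    have hv : v = ∑ i, v i • EuclideanSpace.single i (1 : ℝ) := by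
      ext j; simp [Finset.sum_apply, Pi.single_apply]
    conv_lhs => rw [hv]
    rw [map_sum, Finset.sum_mul]
    refine norm_sum_le_of_le _ fun i _ => ?_
    rw [map_smul, norm_smul, mul_comm]
    exact mul_le_mul (hA i x hx) (PiLp.norm_apply_le v i) (norm_nonneg _) (hA0 i)
  have hne := neBot_nhdsWithin_orthant n
  have hlip : LipschitzOnWith (∑ i, A i).toNNReal (g : E n → ℂ) (orthant n) :=
    (convex_orthant n).lipschitzOnWith_of_nnnorm_fderiv_le
      (fun x hx => smoothFn_differentiableAt g hx) fun x hx => by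
        rw [← NNReal.coe_le_coe]
        exact (hF x hx).trans (Real.le_coe_toNNReal _)
  have hc : Cauchy (Filter.map (g : E n → ℂ) (𝓝[orthant n] 0)) :=
    (cauchy_nhds.mono' hne nhdsWithin_le_nhds).map_of_le hlip.uniformContinuousOn
      (Filter.le_principal_iff.2 self_mem_nhdsWithin)
  exact CompleteSpace.complete hc

/-- The limit of `x^{-μ-1/2} φ(x)` as `x → 0` within the open orthant. -/
def limitAtZero (μ : Fin n → ℝ) (φ : H μ) : ℂ :=
  Filter.limUnder (𝓝[orthant n] (0 : E n)) (weight μ (H.incl μ φ) : E n → ℂ)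

lemma tendsto_limitAtZero (μ : Fin n → ℝ) (φ : H μ) :
    Filter.Tendsto (weight μ (H.incl μ φ) : E n → ℂ) (𝓝[orthant n] 0) (𝓝 (limitAtZero μ φ)) :=
  tendsto_nhds_limUnder (exists_limit μ φ)

/-- The constant `C_μ = ∏ᵢ 2^{μᵢ} Γ(μᵢ + 1)`. -/
def deltaConst (μ : Fin n → ℝ) : ℝ := ∏ i, (2 : ℝ) ^ μ i * Real.Gamma (μ i + 1)

/-- The functional `φ ↦ C_μ lim_{x → 0, xᵢ > 0} x^{-μ-1/2} φ(x)` as a linear map. -/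
def deltaₗ (μ : Fin n → ℝ) : H μ →ₗ[ℂ] ℂ where
  toFun φ := deltaConst μ * limitAtZero μ φ
  map_add' φ ψ := by
    have := neBot_nhdsWithin_orthant n
    have h := (tendsto_limitAtZero μ φ).add (tendsto_limitAtZero μ ψ)
    have h' := tendsto_limitAtZero μ (φ + ψ)
    rw [map_add, map_add] at h'
    rw [tendsto_nhds_unique h' h, mul_add]
  map_smul' c φ := by
    have := neBot_nhdsWithin_orthant n
    have h := (tendsto_limitAtZero μ φ).const_mul c
    have h' := tendsto_limitAtZero μ (c • φ)
    rw [map_smul, map_smul] at h'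
    rw [tendsto_nhds_unique h' h, RingHom.id_apply, smul_eq_mul]
    ring

lemma deltaₗ_continuous (μ : Fin n → ℝ) : Continuous (deltaₗ μ) := by
  refine WithSeminorms.continuous_normedSpace_rng ℂ (withSeminorms_gamma μ) _
    ⟨{(0, 0)}, ‖deltaConst μ‖₊, fun φ => ?_⟩
  have hne := neBot_nhdsWithin_orthant n
  rw [Finset.sup_singleton]
  change ‖(deltaConst μ : ℂ) * limitAtZero μ φ‖ ≤ ‖deltaConst μ‖ * gamma μ (0, 0) φ
  rw [norm_mul, Complex.norm_real]
  refine mul_le_mul_of_nonneg_left ?_ (norm_nonneg _)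
  refine le_of_tendsto (tendsto_limitAtZero μ φ).norm ?_
  filter_upwards [self_mem_nhdsWithin] with x hx
  have := gammaFn_le 0 0 φ hx
  simpa [gammaFn, Tpow_zero, gamma_apply] using this

/-- The generalized delta at the origin,
`(δ_μ, φ) = C_μ lim_{x → 0, xᵢ > 0} x^{-μ-1/2} φ(x)`, as an element of `H'_μ`. -/
def delta (μ : Fin n → ℝ) : Dual μ := ⟨deltaₗ μ, deltaₗ_continuous μ⟩

/-- The finite set of multi-indices `k` with `|k| = k₁ + ⋯ + kₙ ≤ N`. -/
def multiIndices (n N : ℕ) : Finset (Fin n → ℕ) :=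
  (Fintype.piFinset fun _ => Finset.range (N + 1)).filter fun k => ∑ i, k i ≤ N

lemma mem_multiIndices {N : ℕ} {k : Fin n → ℕ} : k ∈ multiIndices n N ↔ ∑ i, k i ≤ N := by
  simp only [multiIndices, Finset.mem_filter, Fintype.mem_piFinset, Finset.mem_range,
    and_iff_right_iff_imp]
  exact fun h i => Nat.lt_succ_of_le
    ((Finset.single_le_sum (fun j _ => Nat.zero_le (k j)) (Finset.mem_univ i)).trans h)

end Zemanian

end

open scoped ContDiff Topology

noncomputable section

namespace Zemanian

variable {n : ℕ}

/-! Sums of multi-indices and compositions of the operators `T^k`. -/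

/-! Write `f = x^{-μ-1/2} φ`. The theorem reduces to linear algebra: a functional that vanishes on
the common kernel of finitely many functionals is a linear combination of them. So it suffices to
find `N` such that `T φ = 0` whenever `(S^k δ_μ, φ) = 0` for all `|k| ≤ N`.

Two facts give this. The first is algebraic. The weight turns `S_{μᵢ}` into `xᵢ² Tᵢ² + (2μᵢ + 2)
Tᵢ`, and at the origin the term with `xᵢ²` disappears because all `T^k f` are bounded. Hence `(S^k
δ_μ, φ)` is a nonzero multiple of `lim T^k f`, and the hypothesis on `φ` says that `T^k f → 0` for
`|k| ≤ N` (`tendsto_zero_of_SpowDual_delta_eq_zero`).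

The second is analytic (`exists_order`). By continuity `T` is bounded by finitely many seminorms;
let `N` be the largest `|k|` in them. If `T^k f → 0` for `|k| ≤ N`, a Taylor estimate in the
variables `xᵢ²` gives `T^k f = O(‖x‖^{2(N+1-|k|)})` (`taylorBound_of_flatAtZero`). Multiplying `φ`
by a cut-off `χ(c‖x‖²)` equal to `1` near the origin does not change `T φ`, by the support
hypothesis (`map_cutH`). It makes each relevant seminorm `O(c^{|k|-(N+1)})`, hence `O(1/c)`
(`exists_cut_bound`). Letting `c → ∞` gives `T φ = 0`. -/

lemma multiIndex_induction {P : (Fin n → ℕ) → Prop} (zero : P 0)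
    (succ : ∀ k i, P k → P (k + Pi.single i 1)) (k : Fin n → ℕ) : P k := by
  obtain ⟨d, hd⟩ : ∃ d, ∑ i, k i = d := ⟨_, rfl⟩
  induction d generalizing k with
  | zero =>
    have : k = 0 := funext fun i => (Finset.sum_eq_zero_iff.1 hd) i (Finset.mem_univ i)
    exact this ▸ zero
  | succ d ih =>
    obtain ⟨i, -, hi⟩ : ∃ i ∈ Finset.univ, k i ≠ 0 :=
      Finset.exists_ne_zero_of_sum_ne_zero (by omega)
    have hk : k - Pi.single i 1 + Pi.single i 1 = k := by
      refine tsub_add_cancel_of_le fun j => ?_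
      rcases eq_or_ne j i with rfl | hj
      · simpa using Nat.one_le_iff_ne_zero.2 hi
      · simp [hj]
    rw [← hk]
    refine succ _ i (ih _ ?_)
    have := congrArg (fun l : Fin n → ℕ => ∑ j, l j) hk
    simp [Finset.sum_add_distrib] at this
    simp at *
    omega

lemma sum_add_single (k : Fin n → ℕ) (i : Fin n) :
    ∑ j, (k + Pi.single i 1 : Fin n → ℕ) j = ∑ j, k j + 1 := by
  simp [Finset.sum_add_distrib]

lemma Tpow_add (j k : Fin n → ℕ) : Tpow (j + k) = Tpow j * Tpow k := by
  induction k using multiIndex_induction with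
  | zero => simp [Tpow_zero]
  | succ k i ih => rw [← add_assoc, Tpow_succ, ih, Tpow_succ, mul_assoc]

lemma Tpow_single (i : Fin n) : Tpow (Pi.single i 1 : Fin n → ℕ) = T i := by
  have := Tpow_succ i 0
  rwa [zero_add, Tpow_zero, one_mul] at this

lemma Tpow_T (k : Fin n → ℕ) (i : Fin n) (f : smoothFn n) :
    Tpow k (T i f) = Tpow (k + Pi.single i 1) f := by
  rw [Tpow_succ, Module.End.mul_apply]

/-! Taylor's estimate at the origin. -/

/-- Every `T^k f` is bounded on the orthant. -/
def BoundedT (f : smoothFn n) : Prop :=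
  ∀ k, ∃ A : ℝ, ∀ x ∈ orthant n, ‖(Tpow k f : E n → ℂ) x‖ ≤ A

/-- Every `T^k f` with `|k| < s` tends to zero at the origin. -/
def FlatAtZero (s : ℕ) (f : smoothFn n) : Prop :=
  ∀ k : Fin n → ℕ, ∑ i, k i < s →
    Filter.Tendsto (Tpow k f : E n → ℂ) (𝓝[orthant n] 0) (𝓝 0)

/-- `T^k f` is `O(‖x‖^{2(s - |k|)})` on the orthant, for every `k`. -/
def TaylorBound (s : ℕ) (f : smoothFn n) : Prop :=
  ∀ k : Fin n → ℕ, ∃ A : ℝ, ∀ x ∈ orthant n,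
    ‖(Tpow k f : E n → ℂ) x‖ ≤ A * ‖x‖ ^ (2 * (s - ∑ i, k i))

lemma BoundedT.tpow {f : smoothFn n} (h : BoundedT f) (k : Fin n → ℕ) : BoundedT (Tpow k f) :=
  fun j => by
    rw [← Module.End.mul_apply, ← Tpow_add]
    exact h _

lemma FlatAtZero.tpow {s : ℕ} {f : smoothFn n} (h : FlatAtZero s f) (k : Fin n → ℕ) :
    FlatAtZero (s - ∑ i, k i) (Tpow k f) := fun j hj => by
  rw [← Module.End.mul_apply, ← Tpow_add]
  refine h _ ?_
  simp only [Pi.add_apply, Finset.sum_add_distrib]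
  omega

lemma smul_mem_orthant {x : E n} (hx : x ∈ orthant n) {t : ℝ} (ht : 0 < t) :
    t • x ∈ orthant n := fun i => by
  simpa using mul_pos ht (hx i)

/-- Since `∂ᵢ = xᵢ Tᵢ`, a radial derivative carries two coordinate factors, `vᵢ` and `xᵢ`. This is
why each order of `T` is worth two powers of `‖x‖`. -/
lemma fderiv_eq_sum_T (f : smoothFn n) {x : E n} (hx : x ∈ orthant n) (v : E n) :
    fderiv ℝ (f : E n → ℂ) x v = ∑ i, ((v i * x i : ℝ) : ℂ) * (T i f : E n → ℂ) x := by
  have hv : v = ∑ i, v i • EuclideanSpace.single i (1 : ℝ) := by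
    ext j; simp [Finset.sum_apply, Pi.single_apply]
  conv_lhs => rw [hv]
  rw [map_sum]
  refine Finset.sum_congr rfl fun i _ => ?_
  have := coord_ne_zero i hx
  rw [map_smul, T_apply, partialD_apply i f hx, Complex.real_smul]
  push_cast
  field_simp

/-- If `f` vanishes at the origin and every `Tᵢ f` is `O(‖x‖^{2s})`, then `f` is
`O(‖x‖^{2s + 2})`. -/
lemma norm_le_of_T_le {f : smoothFn n} {s : ℕ} {A : ℝ} (hA : 0 ≤ A)
    (h0 : Filter.Tendsto (f : E n → ℂ) (𝓝[orthant n] 0) (𝓝 0))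
    (hT : ∀ i, ∀ x ∈ orthant n, ‖(T i f : E n → ℂ) x‖ ≤ A * ‖x‖ ^ (2 * s))
    {x : E n} (hx : x ∈ orthant n) : ‖(f : E n → ℂ) x‖ ≤ n * A * ‖x‖ ^ (2 * (s + 1)) := by
  -- The segment `t • x` is taken over `(0,1]` only: at `t = 0` it leaves the orthant, where `f` is
  -- extended by zero. The endpoint is recovered at the end as a limit.
  have hd : ∀ t ∈ Set.Ioc (0 : ℝ) 1, HasDerivWithinAt (fun t : ℝ => (f : E n → ℂ) (t • x))
      (fderiv ℝ (f : E n → ℂ) (t • x) x) (Set.Ioc 0 1) t := by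
    intro t ht
    have h1 := (smoothFn_differentiableAt f (smul_mem_orthant hx ht.1)).hasFDerivAt
    have h2 : HasDerivAt (fun t : ℝ => t • x) x t := by
      simpa using (hasDerivAt_id t).smul_const x
    exact (h1.comp_hasDerivAt t h2).hasDerivWithinAt
  have hb : ∀ t ∈ Set.Ioc (0 : ℝ) 1, ‖fderiv ℝ (f : E n → ℂ) (t • x) x‖ ≤
      n * A * ‖x‖ ^ (2 * (s + 1)) := by
    intro t ht
    rw [fderiv_eq_sum_T f (smul_mem_orthant hx ht.1)]
    refine (norm_sum_le _ _).trans ?_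
    have : ∀ i ∈ Finset.univ, ‖((x i * (t • x) i : ℝ) : ℂ) * (T i f : E n → ℂ) (t • x)‖ ≤
        A * ‖x‖ ^ (2 * (s + 1)) := by
      intro i _
      have h1 : |x i| ≤ ‖x‖ := by simpa using PiLp.norm_apply_le x i
      have h2 : ‖t • x‖ ≤ ‖x‖ := by
        rw [norm_smul, Real.norm_of_nonneg ht.1.le]
        exact mul_le_of_le_one_left (norm_nonneg _) ht.2
      have h3 : |(t • x) i| ≤ ‖x‖ := by
        refine le_trans ?_ h2
        simpa using PiLp.norm_apply_le (t • x) i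
      have h4 : ‖(T i f : E n → ℂ) (t • x)‖ ≤ A * ‖x‖ ^ (2 * s) :=
        (hT i _ (smul_mem_orthant hx ht.1)).trans (by gcongr)
      rw [norm_mul, Complex.norm_real, Real.norm_eq_abs, abs_mul]
      calc |x i| * |(t • x) i| * ‖(T i f : E n → ℂ) (t • x)‖
          ≤ ‖x‖ * ‖x‖ * (A * ‖x‖ ^ (2 * s)) := by gcongr
        _ = A * ‖x‖ ^ (2 * (s + 1)) := by ring
    refine (Finset.sum_le_sum this).trans ?_
    simp [mul_assoc]
  have hmv : ∀ t ∈ Set.Ioc (0 : ℝ) 1, ‖(f : E n → ℂ) x - (f : E n → ℂ) (t • x)‖ ≤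
      n * A * ‖x‖ ^ (2 * (s + 1)) := by
    intro t ht
    have := (convex_Ioc (0 : ℝ) 1).norm_image_sub_le_of_norm_hasDerivWithin_le hd hb ht
      (⟨one_pos, le_rfl⟩ : (1 : ℝ) ∈ Set.Ioc (0 : ℝ) 1)
    rw [one_smul] at this
    refine this.trans (mul_le_of_le_one_right (by positivity) ?_)
    rw [Real.norm_of_nonneg (by linarith [ht.2])]
    linarith [ht.1]
  have hray : Filter.Tendsto (fun t : ℝ => t • x) (𝓝[>] 0) (𝓝[orthant n] 0) := by
    refine tendsto_nhdsWithin_iff.2 ⟨?_, ?_⟩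
    · have : Continuous fun t : ℝ => t • x := by fun_prop
      simpa using (this.tendsto 0).mono_left nhdsWithin_le_nhds
    · filter_upwards [self_mem_nhdsWithin] with t ht using smul_mem_orthant hx ht
  have hlim := (tendsto_const_nhds (x := (f : E n → ℂ) x)).sub (h0.comp hray)
  rw [sub_zero] at hlim
  refine le_of_tendsto hlim.norm ?_
  filter_upwards [Ioc_mem_nhdsGT (zero_lt_one' ℝ)] with t ht using hmv t ht

/-- Induction on `s`: each `Tᵢ f` is flat to one order less, so its bound integrates along rays to
the bound for `f`. -/
lemma exists_norm_le_of_flatAtZero {s : ℕ} {f : smoothFn n} (hB : BoundedT f)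
    (hZ : FlatAtZero s f) : ∃ A : ℝ, ∀ x ∈ orthant n, ‖(f : E n → ℂ) x‖ ≤ A * ‖x‖ ^ (2 * s) := by
  induction s generalizing f with
  | zero => simpa [Tpow_zero] using hB 0
  | succ s ih =>
    have h : ∀ i, ∃ A : ℝ, ∀ x ∈ orthant n, ‖(T i f : E n → ℂ) x‖ ≤ A * ‖x‖ ^ (2 * s) := by
      intro i
      rw [← Tpow_single i]
      refine ih (hB.tpow _) ?_
      have := hZ.tpow (Pi.single i 1)
      simpa using this
    choose A hA using h
    refine ⟨n * ∑ i, |A i|, fun x hx => norm_le_of_T_le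
      (Finset.sum_nonneg fun i _ => abs_nonneg _) ?_ (fun i y hy => (hA i y hy).trans ?_) hx⟩
    · simpa [Tpow_zero] using hZ 0 (by simp)
    · gcongr
      exact (le_abs_self _).trans
        (Finset.single_le_sum (f := fun i => |A i|) (fun i _ => abs_nonneg _) (Finset.mem_univ i))

/-- `T^k f` is itself flat to order `s - |k|`. The subtraction is truncated, so for `|k| ≥ s` the
estimate is mere boundedness. -/
lemma taylorBound_of_flatAtZero {s : ℕ} {f : smoothFn n} (hB : BoundedT f)
    (hZ : FlatAtZero s f) : TaylorBound s f :=
  fun k => exists_norm_le_of_flatAtZero (hB.tpow k) (hZ.tpow k)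

lemma TaylorBound.T {s : ℕ} {f : smoothFn n} (h : TaylorBound s f) (i : Fin n) :
    TaylorBound (s - 1) (T i f) := fun k => by
  rw [Tpow_T]
  convert h (k + Pi.single i 1) using 7
  rw [sum_add_single]
  omega

/-! Cut-off functions. -/

/-- The smooth functions on the line that vanish on `(1,∞)`. -/
def IsCutoff (χ : ℝ → ℂ) : Prop := ContDiff ℝ ∞ χ ∧ ∀ t, 1 < t → χ t = 0

lemma IsCutoff.deriv {χ : ℝ → ℂ} (h : IsCutoff χ) : IsCutoff (deriv χ) := by
  refine ⟨(contDiff_infty_iff_deriv.1 h.1).2, fun t ht => ?_⟩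
  have : χ =ᶠ[𝓝 t] fun _ => 0 := by
    filter_upwards [Ioi_mem_nhds ht] with u hu using h.2 u hu
  rw [this.deriv_eq]
  simp

lemma IsCutoff.contDiff_comp {χ : ℝ → ℂ} (h : IsCutoff χ) (c : ℝ) :
    ContDiff ℝ ∞ (fun x : E n => χ (c * ‖x‖ ^ 2)) :=
  h.1.comp (contDiff_const.mul (contDiff_norm_sq ℝ))

/-- Multiplication by `χ(c‖x‖²)`. -/
def cut {χ : ℝ → ℂ} (h : IsCutoff χ) (c : ℝ) : Module.End ℂ (smoothFn n) :=
  mulBy (fun x => χ (c * ‖x‖ ^ 2)) (h.contDiff_comp c).contDiffOn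

/-- Because `Tᵢ‖x‖² = 2`, differentiating the cut-off produces the constant `2c` and no function of
`x`; hence the choice of a function of `‖x‖²`. -/
lemma T_cut {χ : ℝ → ℂ} (h : IsCutoff χ) (c : ℝ) (i : Fin n) (f : smoothFn n) :
    T i (cut h c f) = ((2 * c : ℝ) : ℂ) • cut h.deriv c f + cut h c (T i f) := by
  refine smoothFn_ext fun x hx => ?_
  have h0 := coord_ne_zero i hx
  have h1 : fderiv ℝ (fun x : E n => χ (c * ‖x‖ ^ 2)) x (EuclideanSpace.single i 1) =
      ((2 * c * x i : ℝ) : ℂ) * deriv χ (c * ‖x‖ ^ 2) := by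
    have h2 : HasFDerivAt (fun x : E n => c * ‖x‖ ^ 2) (c • (2 • (innerSL ℝ x))) x :=
      (hasStrictFDerivAt_norm_sq x).hasFDerivAt.const_mul c
    have h3 := ((h.1.differentiable (by simp)) (c * ‖x‖ ^ 2)).hasDerivAt.hasFDerivAt.comp x h2
    have h4 : HasFDerivAt (fun x : E n => χ (c * ‖x‖ ^ 2)) _ x := h3
    rw [h4.fderiv]
    simp [EuclideanSpace.inner_single_right]
    ring
  rw [T_apply]
  unfold cut
  rw [partialD_mulBy i _ _ f hx, h1]
  simp only [Submodule.coe_add, Submodule.coe_smul, Pi.add_apply, Pi.smul_apply, smul_eq_mul,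
    mulBy_apply, T_apply]
  push_cast
  field_simp

/-- On the support of the cut-off `‖x‖² ≤ 1/c`, so `f = O(c^{-s})` there. Each `Tᵢ` either falls on
the cut-off and costs a factor `c`, or falls on `f` and lowers `s` by one; either way one power of
`c` is lost. The induction varies `χ`, `s` and `f` because it passes to `χ'` and to `Tᵢ f`. The
constant must not depend on `c`. -/
lemma exists_cut_bound {χ : ℝ → ℂ} (h : IsCutoff χ) (m : ℕ) (k : Fin n → ℕ) (s : ℕ)
    (f : smoothFn n) (hf : TaylorBound s f) :
    ∃ C : ℝ, 0 ≤ C ∧ ∀ c : ℝ, 1 ≤ c → ∀ x ∈ orthant n,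
      (1 + ‖x‖ ^ 2) ^ m * ‖(Tpow k (cut h c f) : E n → ℂ) x‖ * c ^ s ≤ C * c ^ (∑ i, k i) := by
  induction k using multiIndex_induction generalizing χ s f with
  | zero =>
    obtain ⟨A, hA⟩ := hf 0
    obtain ⟨M, hM⟩ := (isCompact_Icc (a := (0 : ℝ)) (b := 1)).exists_bound_of_continuousOn
      h.1.continuous.continuousOn
    have hM0 : 0 ≤ M := (norm_nonneg _).trans (hM 0 ⟨le_rfl, zero_le_one⟩)
    refine ⟨2 ^ m * (M * |A|), by positivity, fun c hc x hx => ?_⟩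
    have hc0 : 0 < c := by linarith
    have e : (Tpow 0 (cut h c f) : E n → ℂ) x = χ (c * ‖x‖ ^ 2) * (f : E n → ℂ) x := by
      rw [Tpow_zero]; rfl
    have hA' := hA x hx
    simp only [Tpow_zero, Module.End.one_apply, Pi.zero_apply, Finset.sum_const_zero,
      Nat.sub_zero] at hA'
    rw [e, norm_mul]
    simp only [Pi.zero_apply, Finset.sum_const_zero, pow_zero, mul_one]
    by_cases hcx : 1 < c * ‖x‖ ^ 2
    · rw [h.2 _ hcx, norm_zero]
      simp only [zero_mul, mul_zero]
      positivity
    · rw [not_lt] at hcx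
      -- As `c ≥ 1`, the support lies in the unit ball, so the polynomial weight is at most `2^m`.
      have h1 : ‖x‖ ^ 2 ≤ 1 := by nlinarith [sq_nonneg ‖x‖]
      have h2 : (1 + ‖x‖ ^ 2) ^ m ≤ 2 ^ m := pow_le_pow_left₀ (by positivity) (by linarith) m
      have h3 := hM (c * ‖x‖ ^ 2) ⟨by positivity, hcx⟩
      have h4 : ‖(f : E n → ℂ) x‖ * c ^ s ≤ |A| := by
        calc ‖(f : E n → ℂ) x‖ * c ^ s ≤ |A| * ‖x‖ ^ (2 * s) * c ^ s := by
              gcongr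
              exact hA'.trans (by gcongr; exact le_abs_self A)
          _ = |A| * (c * ‖x‖ ^ 2) ^ s := by rw [mul_pow, pow_mul]; ring
          _ ≤ |A| := mul_le_of_le_one_right (abs_nonneg _) (pow_le_one₀ (by positivity) hcx)
      calc (1 + ‖x‖ ^ 2) ^ m * (‖χ (c * ‖x‖ ^ 2)‖ * ‖(f : E n → ℂ) x‖) * c ^ s
          = (1 + ‖x‖ ^ 2) ^ m * (‖χ (c * ‖x‖ ^ 2)‖ * (‖(f : E n → ℂ) x‖ * c ^ s)) := by ring
        _ ≤ 2 ^ m * (M * |A|) := by gcongr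
  | succ k i ih =>
    obtain ⟨C₁, hC₁, h₁⟩ := ih h.deriv s f hf
    obtain ⟨C₂, hC₂, h₂⟩ := ih h (s - 1) (T i f) (hf.T i)
    refine ⟨2 * C₁ + C₂, by positivity, fun c hc x hx => ?_⟩
    have hc0 : 0 < c := by linarith
    have e : (Tpow (k + Pi.single i 1) (cut h c f) : E n → ℂ) x =
        ((2 * c : ℝ) : ℂ) * (Tpow k (cut h.deriv c f) : E n → ℂ) x +
          (Tpow k (cut h c (T i f)) : E n → ℂ) x := by
      rw [← Tpow_T, T_cut, map_add, map_smul]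
      rfl
    -- An equality unless `s = 0`, where truncated subtraction leaves `1 ≤ c`.
    have h3 : c ^ s ≤ c * c ^ (s - 1) := by
      rw [← pow_succ']
      exact pow_le_pow_right₀ hc (by omega)
    have e1 := h₁ c hc x hx
    have e2 := h₂ c hc x hx
    set w := (1 + ‖x‖ ^ 2) ^ m
    have hw : 0 ≤ w := by positivity
    set a := ‖(Tpow k (cut h.deriv c f) : E n → ℂ) x‖
    set b := ‖(Tpow k (cut h c (T i f)) : E n → ℂ) x‖
    rw [sum_add_single, pow_succ, e]
    calc w * ‖((2 * c : ℝ) : ℂ) * (Tpow k (cut h.deriv c f) : E n → ℂ) x +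
          (Tpow k (cut h c (T i f)) : E n → ℂ) x‖ * c ^ s
        ≤ w * (2 * c * a + b) * c ^ s := by
          gcongr
          refine (norm_add_le _ _).trans ?_
          rw [norm_mul, Complex.norm_real, Real.norm_of_nonneg (by positivity)]
      _ = 2 * c * (w * a * c ^ s) + w * b * c ^ s := by ring
      _ ≤ 2 * c * (w * a * c ^ s) + w * b * (c * c ^ (s - 1)) := by gcongr
      _ = 2 * c * (w * a * c ^ s) + c * (w * b * c ^ (s - 1)) := by ring
      _ ≤ 2 * c * (C₁ * c ^ (∑ i, k i)) + c * (C₂ * c ^ (∑ i, k i)) := by gcongr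
      _ = (2 * C₁ + C₂) * (c ^ (∑ i, k i) * c) := by ring

/-- A cut-off function that equals `1` on `(-∞,1/2]`. -/
def stdCutoff (t : ℝ) : ℂ := (Real.smoothTransition (2 - 2 * t) : ℝ)

lemma isCutoff_stdCutoff : IsCutoff stdCutoff := by
  refine ⟨Complex.ofRealCLM.contDiff.comp
    (Real.smoothTransition.contDiff.comp (by fun_prop : ContDiff ℝ ∞ fun t : ℝ => 2 - 2 * t)),
    fun t ht => ?_⟩
  simp [stdCutoff, Real.smoothTransition.zero_of_nonpos (by linarith : 2 - 2 * t ≤ 0)]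

lemma stdCutoff_of_le {t : ℝ} (ht : t ≤ 1 / 2) : stdCutoff t = 1 := by
  simp [stdCutoff, Real.smoothTransition.one_of_one_le (by linarith : 1 ≤ 2 - 2 * t)]

/-! The Bessel operators and the limits of `T^k{x^{-μ-1/2} φ(x)}` at the origin. -/

/-- The operator `xᵢ² Tᵢ² + a Tᵢ`. -/
def besselT (i : Fin n) (a : ℂ) : Module.End ℂ (smoothFn n) := mulSq i * T i ^ 2 + a • T i

/-- The commutator of `Tⱼ` with `xᵢ²` is `2` when `i = j` and `0` otherwise, so moving `Tⱼ` across
only shifts the parameter `a`. -/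
lemma T_besselT (i j : Fin n) (a : ℂ) :
    T j * besselT i a = besselT i (a + if i = j then 2 else 0) * T j := by
  have hc : T j * T i = T i * T j := T_commute j i
  have hc2 : T j * T i ^ 2 = T i ^ 2 * T j := (T_commute j i).pow_right 2
  simp only [besselT, mul_add, add_mul, mul_smul_comm, smul_mul_assoc, ← mul_assoc, T_mulSq]
  rw [mul_assoc _ (T j), hc2, hc]
  by_cases h : i = j
  · subst h
    simp only [if_true, one_mul, mul_assoc, add_smul, pow_two]
    abel
  · simp [h, mul_assoc]

lemma Tpow_besselT (i : Fin n) (a : ℂ) (k : Fin n → ℕ) :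
    Tpow k * besselT i a = besselT i (a + 2 * k i) * Tpow k := by
  induction k using multiIndex_induction generalizing a with
  | zero => simp [Tpow_zero]
  | succ k j ih =>
    rw [Tpow_succ, mul_assoc, T_besselT, ← mul_assoc, ih, mul_assoc]
    congr 2
    by_cases h : i = j
    · subst h; simp; ring
    · simp [h]

lemma Tpow_bounded {μ : Fin n → ℝ} (φ : H μ) : BoundedT (weight μ (H.incl μ φ)) := fun k =>
  ⟨_, fun x hx => by simpa [gammaFn] using gammaFn_le 0 k φ hx⟩

/-- Moving `T^k` past the transformed Bessel operator adds `2kᵢ` to its coefficient. The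
second-order term tends to zero, being `xᵢ²` times a bounded function. -/
lemma tendsto_Tpow_besselH {μ : Fin n → ℝ} (k : Fin n → ℕ) (i : Fin n) (φ : H μ) {l : ℂ}
    (h : Filter.Tendsto (Tpow (k + Pi.single i 1) (weight μ (H.incl μ φ)) : E n → ℂ)
      (𝓝[orthant n] 0) (𝓝 l)) :
    Filter.Tendsto (Tpow k (weight μ (H.incl μ (besselH μ i φ))) : E n → ℂ)
      (𝓝[orthant n] 0) (𝓝 ((2 * (μ i : ℂ) + 2 + 2 * k i) * l)) := by
  set f := weight μ (H.incl μ φ) with hf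
  have e : Tpow k (weight μ (H.incl μ (besselH μ i φ))) =
      besselT i (2 * (μ i : ℂ) + 2 + 2 * k i) (Tpow k f) := by
    have h1 : weight μ (H.incl μ (besselH μ i φ)) = besselT i (2 * (μ i : ℂ) + 2) f :=
      LinearMap.congr_fun (weight_besselS μ i) (H.incl μ φ)
    rw [h1]
    exact LinearMap.congr_fun (Tpow_besselT i _ k) f
  have hc : ∀ (j : Fin n → ℕ) (g : smoothFn n), T i (Tpow j g) = Tpow (j + Pi.single i 1) g :=
    fun j g => by rw [add_comm, Tpow_add, Tpow_single, Module.End.mul_apply]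
  have e' : (Tpow k (weight μ (H.incl μ (besselH μ i φ))) : E n → ℂ) = fun x =>
      (x i : ℂ) ^ 2 * (Tpow (k + Pi.single i 1 + Pi.single i 1) f : E n → ℂ) x +
        (2 * (μ i : ℂ) + 2 + 2 * k i) * (Tpow (k + Pi.single i 1) f : E n → ℂ) x := by
    rw [e, besselT, pow_two]
    simp only [LinearMap.add_apply, Module.End.mul_apply, LinearMap.smul_apply]
    rw [hc k f, ← hc (k + Pi.single i 1) f]
    rfl
  rw [e', ← zero_add ((2 * (μ i : ℂ) + 2 + 2 * k i) * l)]
  refine Filter.Tendsto.add ?_ (h.const_mul _)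
  obtain ⟨A, hA⟩ := Tpow_bounded φ (k + Pi.single i 1 + Pi.single i 1)
  have hx : Filter.Tendsto (fun x : E n => (x i : ℂ) ^ 2) (𝓝[orthant n] 0) (𝓝 0) := by
    have h1 : Continuous fun x : E n => (x i : ℂ) ^ 2 := (coord_contDiff i).continuous.pow 2
    simpa using (h1.tendsto 0).mono_left nhdsWithin_le_nhds
  refine hx.zero_mul_isBoundedUnder_le ⟨A, ?_⟩
  rw [Filter.eventually_map]
  filter_upwards [self_mem_nhdsWithin] with x hx using hA x hx

lemma tendsto_Tpow_besselH_pow {μ : Fin n → ℝ} (hμ : ∀ i, -1 / 2 ≤ μ i) (k : Fin n → ℕ)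
    (i : Fin n) (r : ℕ) : ∃ c : ℂ, c ≠ 0 ∧ ∀ (φ : H μ) (l : ℂ),
      Filter.Tendsto (Tpow (k + Pi.single i r) (weight μ (H.incl μ φ)) : E n → ℂ)
        (𝓝[orthant n] 0) (𝓝 l) →
      Filter.Tendsto (Tpow k (weight μ (H.incl μ ((besselH μ i ^ r) φ))) : E n → ℂ)
        (𝓝[orthant n] 0) (𝓝 (c * l)) := by
  induction r generalizing k with
  | zero => exact ⟨1, one_ne_zero, fun φ l h => by simpa using h⟩
  | succ r ih =>
    obtain ⟨c, hc, h⟩ := ih (k + Pi.single i 1)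
    refine ⟨(2 * (μ i : ℂ) + 2 + 2 * k i) * c, mul_ne_zero ?_ hc, fun φ l hl => ?_⟩
    -- The only place in the induction where `μᵢ ≥ -1/2` enters: the coefficient is positive.
    · have h1 : (0 : ℝ) < 2 * μ i + 2 + 2 * k i := by
        have := hμ i
        have : (0 : ℝ) ≤ k i := Nat.cast_nonneg _
        linarith
      exact_mod_cast h1.ne'
    · rw [pow_succ', mul_apply_eq_comp, mul_assoc]
      refine tendsto_Tpow_besselH k i _ (h φ l ?_)
      rwa [add_assoc, ← Pi.single_add, add_comm 1 r]

/-- Stated for an arbitrary list and an arbitrary starting `k`, so that induction can follow the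
list product defining `Spow`. -/
lemma tendsto_Tpow_besselH_list {μ : Fin n → ℝ} (hμ : ∀ i, -1 / 2 ≤ μ i) (m : Fin n → ℕ)
    (L : List (Fin n)) (k : Fin n → ℕ) : ∃ c : ℂ, c ≠ 0 ∧ ∀ (φ : H μ) (l : ℂ),
      Filter.Tendsto (Tpow (k + (L.map fun i => Pi.single i (m i)).sum)
        (weight μ (H.incl μ φ)) : E n → ℂ) (𝓝[orthant n] 0) (𝓝 l) →
      Filter.Tendsto (Tpow k
        (weight μ (H.incl μ ((L.map fun i => besselH μ i ^ m i).prod φ))) : E n → ℂ)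
        (𝓝[orthant n] 0) (𝓝 (c * l)) := by
  induction L generalizing k with
  | nil => exact ⟨1, one_ne_zero, fun φ l h => by simpa using h⟩
  | cons a L ih =>
    obtain ⟨c, hc, h⟩ := tendsto_Tpow_besselH_pow hμ k a (m a)
    obtain ⟨d, hd, h'⟩ := ih (k + Pi.single a (m a))
    refine ⟨c * d, mul_ne_zero hc hd, fun φ l hl => ?_⟩
    rw [List.map_cons, List.prod_cons, mul_apply_eq_comp, mul_assoc]
    refine h _ _ (h' φ l ?_)
    rwa [List.map_cons, List.sum_cons, ← add_assoc] at hl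

/-- For `φ` in `H_μ` the functions `T^k{x^{-μ-1/2} φ(x)}` have limits at the origin. -/
lemma exists_limit_Tpow {μ : Fin n → ℝ} (φ : H μ) (k : Fin n → ℕ) :
    ∃ l, Filter.Tendsto (Tpow k (weight μ (H.incl μ φ)) : E n → ℂ)
      (𝓝[orthant n] 0) (𝓝 l) := by
  set g := Tpow k (weight μ (H.incl μ φ)) with hg
  -- Multiplying `g` by `x^{μ+1/2}` gives an element of `H_μ` whose weighted function is `g`, so the
  -- case `k = 0` applies to it.
  have hw : weight μ (mulRpow (fun i => μ i + 1 / 2) g) = g := by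
    refine smoothFn_ext fun x hx => ?_
    change ((∏ i, x i ^ (-μ i - 1 / 2) : ℝ) : ℂ) *
      (((∏ i, x i ^ (μ i + 1 / 2) : ℝ) : ℂ) * (g : E n → ℂ) x) = _
    rw [← mul_assoc, ← Complex.ofReal_mul, ← Finset.prod_mul_distrib]
    have : ∀ i ∈ Finset.univ, x i ^ (-μ i - 1 / 2) * x i ^ (μ i + 1 / 2) = 1 := fun i _ => by
      rw [← Real.rpow_add (hx i), show -μ i - 1 / 2 + (μ i + 1 / 2) = 0 by ring, Real.rpow_zero]
    rw [Finset.prod_eq_one this]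
    simp
  have hm : mulRpow (fun i => μ i + 1 / 2) g ∈ space μ := fun m j => by
    have : gammaFn μ m j (mulRpow (fun i => μ i + 1 / 2) g) =
        gammaFn μ m (j + k) (H.incl μ φ) := by
      funext x
      rw [gammaFn, hw, gammaFn, Tpow_add, Module.End.mul_apply]
    rw [this]
    exact φ.2 m (j + k)
  obtain ⟨l, hl⟩ := exists_limit μ (⟨_, hm⟩ : space μ)
  refine ⟨l, ?_⟩
  have : weight μ (H.incl μ (⟨_, hm⟩ : space μ)) = g := hw
  rwa [this] at hl

lemma deltaConst_pos {μ : Fin n → ℝ} (hμ : ∀ i, -1 / 2 ≤ μ i) : 0 < deltaConst μ :=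
  Finset.prod_pos fun i _ => mul_pos (Real.rpow_pos_of_pos two_pos _)
    (Real.Gamma_pos_of_pos (by linarith [hμ i]))

/-- If `S^k δ_μ` annihilates `φ`, then `T^k{x^{-μ-1/2} φ(x)}` tends to zero at the origin. -/
lemma tendsto_zero_of_SpowDual_delta_eq_zero {μ : Fin n → ℝ} (hμ : ∀ i, -1 / 2 ≤ μ i)
    (k : Fin n → ℕ) (φ : H μ) (h : SpowDual μ k (delta μ) φ = 0) :
    Filter.Tendsto (Tpow k (weight μ (H.incl μ φ)) : E n → ℂ) (𝓝[orthant n] 0) (𝓝 0) := by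
  have hne := neBot_nhdsWithin_orthant n
  obtain ⟨l, hl⟩ := exists_limit_Tpow φ k
  obtain ⟨c, hc, hS⟩ := tendsto_Tpow_besselH_list hμ k (List.finRange n) 0
  have hk : 0 + ((List.finRange n).map fun i => (Pi.single i (k i) : Fin n → ℕ)).sum = k := by
    rw [zero_add, ← List.ofFn_eq_map, List.sum_ofFn]
    exact Finset.univ_sum_single k
  rw [hk] at hS
  have h1 := hS φ l hl
  rw [Tpow_zero] at h1
  have h2 := tendsto_nhds_unique (tendsto_limitAtZero μ (Spow μ k φ)) h1
  have h3 : (deltaConst μ : ℂ) * limitAtZero μ (Spow μ k φ) = 0 := h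
  rw [h2] at h3
  have h4 : (deltaConst μ : ℂ) ≠ 0 := Complex.ofReal_ne_zero.2 (deltaConst_pos hμ).ne'
  have h5 : l = 0 := by simpa [h4, hc] using h3
  exact h5 ▸ hl

/-! Functionals supported at the origin. -/

lemma weight_cut {χ : ℝ → ℂ} (h : IsCutoff χ) (c : ℝ) (μ : Fin n → ℝ) (f : smoothFn n) :
    weight μ (cut h c f) = cut h c (weight μ f) := by
  ext x
  exact mul_left_comm _ _ _

lemma norm_gammaFn (μ : Fin n → ℝ) (m : ℕ) (k : Fin n → ℕ) (f : smoothFn n) (x : E n) :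
    ‖gammaFn μ m k f x‖ = (1 + ‖x‖ ^ 2) ^ m * ‖(Tpow k (weight μ f) : E n → ℂ) x‖ := by
  rw [gammaFn, norm_mul, norm_pow, Complex.norm_real, Real.norm_of_nonneg (by positivity)]

/-- The case `s = 0` of the cut-off estimate, where flatness is vacuous and boundedness suffices. -/
lemma cut_mem_space {χ : ℝ → ℂ} (h : IsCutoff χ) {c : ℝ} (hc : 1 ≤ c) {μ : Fin n → ℝ}
    (φ : H μ) : cut h c (H.incl μ φ) ∈ space μ := fun m k => by
  have hT : TaylorBound 0 (weight μ (H.incl μ φ)) := fun k => by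
    simpa using Tpow_bounded φ k
  obtain ⟨C, -, hC⟩ := exists_cut_bound h m k 0 _ hT
  refine ⟨C * c ^ (∑ i, k i), ?_⟩
  rintro _ ⟨x, rfl⟩
  have := hC c hc x x.2
  rw [pow_zero, mul_one] at this
  change ‖gammaFn μ m k (cut h c (H.incl μ φ)) x‖ ≤ _
  rwa [norm_gammaFn, weight_cut]

/-- The product of `φ` and `χ(c‖x‖²)` as an element of `H_μ`. -/
def cutH {χ : ℝ → ℂ} (h : IsCutoff χ) {c : ℝ} (hc : 1 ≤ c) {μ : Fin n → ℝ} (φ : H μ) : H μ :=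
  (⟨cut h c (H.incl μ φ), cut_mem_space h hc φ⟩ : space μ)

lemma exists_gamma_cutH_le {χ : ℝ → ℂ} (h : IsCutoff χ) {μ : Fin n → ℝ} {N : ℕ} (φ : H μ)
    (hφ : FlatAtZero (N + 1) (weight μ (H.incl μ φ))) (p : ℕ × (Fin n → ℕ))
    (hp : ∑ i, p.2 i ≤ N) :
    ∃ C : ℝ, 0 ≤ C ∧ ∀ (c : ℝ) (hc : 1 ≤ c), gamma μ p (cutH h hc φ) ≤ C / c := by
  obtain ⟨C, hC0, hC⟩ := exists_cut_bound h p.1 p.2 (N + 1) _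
    (taylorBound_of_flatAtZero (Tpow_bounded φ) hφ)
  refine ⟨C, hC0, fun c hc => ?_⟩
  have hne := orthant_nonempty n
  have hc0 : 0 < c := by linarith
  refine ciSup_le fun x => ?_
  have h1 := hC c hc x x.2
  have e : H.incl μ (cutH h hc φ) = cut h c (H.incl μ φ) := rfl
  rw [e, norm_gammaFn, weight_cut, le_div_iff₀ hc0]
  -- After multiplication by `c^N` the claim follows from the bound `C c^{|k|} ≤ C c^N`.
  refine le_of_mul_le_mul_right ?_ (pow_pos hc0 N)
  rw [mul_assoc, ← pow_succ']
  exact h1.trans (mul_le_mul_of_nonneg_left (pow_le_pow_right₀ hc hp) hC0)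

lemma map_cutH {μ : Fin n → ℝ} {T : Dual μ}
    (hT : ∀ φ : H μ, (∃ a : ℝ, 0 < a ∧ tsupport φ.toFun ⊆ {x | a ≤ ‖x‖}) → T φ = 0)
    {c : ℝ} (hc : 1 ≤ c) (φ : H μ) : T (cutH isCutoff_stdCutoff hc φ) = T φ := by
  have hc0 : 0 < c := by linarith
  -- The radius `1/(2c)` avoids a square root: if `‖x‖ < 1/(2c)` then `‖x‖ ≤ 1`, so `c‖x‖² ≤ c‖x‖ <
  -- 1/2` and the cut-off equals `1` at `x`.
  have h := hT (φ - cutH isCutoff_stdCutoff hc φ) ⟨1 / (2 * c), by positivity, ?_⟩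
  · rw [map_sub, sub_eq_zero] at h
    exact h.symm
  · refine closure_minimal (fun x hx => ?_) (isClosed_le continuous_const continuous_norm)
    by_contra hlt
    rw [Set.mem_ofPred_eq, not_le] at hlt
    refine hx ?_
    have h1 : c * ‖x‖ ^ 2 ≤ 1 / 2 := by
      have h2 : ‖x‖ * (2 * c) < 1 := (lt_div_iff₀ (by positivity)).1 hlt
      have h3 : ‖x‖ ≤ 1 := by nlinarith [norm_nonneg x]
      nlinarith [norm_nonneg x]
    change H.toFun φ x - stdCutoff (c * ‖x‖ ^ 2) * H.toFun φ x = 0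
    rw [stdCutoff_of_le h1, one_mul, sub_self]

/-- A functional supported at the origin annihilates every `φ` for which sufficiently many of the
functions `T^k{x^{-μ-1/2} φ(x)}` tend to zero at the origin. -/
lemma exists_order {μ : Fin n → ℝ} {T : Dual μ}
    (hT : ∀ φ : H μ, (∃ a : ℝ, 0 < a ∧ tsupport φ.toFun ⊆ {x | a ≤ ‖x‖}) → T φ = 0) :
    ∃ N : ℕ, ∀ φ : H μ, FlatAtZero (N + 1) (weight μ (H.incl μ φ)) → T φ = 0 := by
  obtain ⟨s, B, -, hB⟩ := Seminorm.bound_of_continuous (withSeminorms_gamma μ)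
    ((normSeminorm ℂ ℂ).comp T.toLinearMap) (continuous_norm.comp T.continuous)
  -- `N` is the highest order `|k|` among the seminorms that control `T`.
  refine ⟨s.sup fun p => ∑ i, p.2 i, fun φ hφ => ?_⟩
  have h1 : ∀ p : s, ∃ C : ℝ, 0 ≤ C ∧ ∀ (c : ℝ) (hc : 1 ≤ c),
      gamma μ p (cutH isCutoff_stdCutoff hc φ) ≤ C / c := fun p =>
    exists_gamma_cutH_le _ φ hφ p (Finset.le_sup (f := fun p => ∑ i, p.2 i) p.2)
  choose C hC0 hC using h1
  have hS0 : 0 ≤ ∑ p, C p := Finset.sum_nonneg fun p _ => hC0 p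
  have h2 : ∀ c : ℝ, 1 ≤ c → ‖T φ‖ ≤ B * ((∑ p, C p) / c) := by
    intro c hc
    have hc0 : 0 < c := by linarith
    rw [← map_cutH hT hc φ]
    refine (hB (cutH isCutoff_stdCutoff hc φ)).trans ?_
    change (B : ℝ) * (s.sup (gamma μ)) _ ≤ _
    refine mul_le_mul_of_nonneg_left ?_ B.2
    refine Seminorm.finset_sup_apply_le (by positivity) fun p hp => (hC ⟨p, hp⟩ c hc).trans ?_
    gcongr
    exact Finset.single_le_sum (f := C) (fun p _ => hC0 p) (Finset.mem_univ (⟨p, hp⟩ : s))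
  have h3 : Filter.Tendsto (fun c : ℝ => B * ((∑ p, C p) / c)) Filter.atTop (𝓝 0) := by
    simpa using (Filter.Tendsto.const_div_atTop Filter.tendsto_id (∑ p, C p)).const_mul (B : ℝ)
  rw [← norm_le_zero_iff]
  refine ge_of_tendsto h3 ?_
  filter_upwards [Filter.eventually_ge_atTop 1] with c hc using h2 c hc

end Zemanian

end

theorem mainTheorem3 (n : ℕ) (μ : Fin n → ℝ) (hμ : ∀ i, -1 / 2 ≤ μ i) (T : Zemanian.Dual μ)
    (hT : ∀ φ : Zemanian.H μ,
      (∃ a : ℝ, 0 < a ∧ tsupport φ.toFun ⊆ {x | a ≤ ‖x‖}) → T φ = 0) :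
    ∃ (N : ℕ) (c : (Fin n → ℕ) → ℂ),
      T = ∑ k ∈ Zemanian.multiIndices n N, c k • Zemanian.SpowDual μ k (Zemanian.delta μ) := by
  obtain ⟨N, hN⟩ := Zemanian.exists_order hT
  -- Flatness to order `N + 1` asks for the limits with `|k| < N + 1`, which are exactly those
  -- governed by the functionals with `|k| ≤ N`.
  have hker : ⨅ k : Zemanian.multiIndices n N,
      LinearMap.ker (Zemanian.SpowDual μ k (Zemanian.delta μ)).toLinearMap ≤
        LinearMap.ker T.toLinearMap := fun φ hφ => by
    rw [Submodule.mem_iInf] at hφ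
    refine hN φ fun k hk => Zemanian.tendsto_zero_of_SpowDual_delta_eq_zero hμ k φ ?_
    exact hφ ⟨k, Zemanian.mem_multiIndices.2 (Nat.lt_succ_iff.1 hk)⟩
  obtain ⟨c, hc⟩ := (Submodule.mem_span_range_iff_exists_fun ℂ).1
    (mem_span_of_iInf_ker_le_ker hker)
  classical
  refine ⟨N, fun k => if hk : k ∈ Zemanian.multiIndices n N then c ⟨k, hk⟩ else 0, ?_⟩
  ext φ
  have h := LinearMap.congr_fun hc φ
  rw [← Finset.sum_coe_sort]
  simpa using h.symm
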